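/- Let $\mathcal E_M(\mathbb C)$ be the algebra of moderate nets: families $(u_\varepsilon)_{\varepsilon\in(0,1)}$ of functions $u_\varepsilon\in C^\infty(\mathbb R^2;\mathbb C)$ (with $\mathbb C=\mathbb R^2$) such that for every $m\in\mathbb N_0$ and every compact $K\subset\mathbb C$ there is $a\in\mathbb R$ with $$\max_{|\alpha|\le m}\ \sup_{z\in K}|\partial^\alpha u_\varepsilon(z)|=O(\varepsilon^{a})\quad(\varepsilon\to0).$$ Let $\mathcal N(\mathbb C)$ be the ideal of negligible nets, those for which this estimate holds for all $m$, all $K$ and every $a\in\mathbb R$, and let $\mathcal G(\mathbb C)=\mathcal E_M(\mathbb C)/\mathcal N(\mathbb C)$ be the Colombeau algebra of generalized functions on $\mathbb C$. The operator $\frac{\partial}{\partial\bar z}=\frac12\left(\frac{\partial}{\partial x}+i\frac{\partial}{\partial y}\right)$ acts on $\mathcal G(\mathbb C)$ by acting on each member of a representative, and $\mathcal G_H(\mathbb C)=\{f\in\mathcal G(\mathbb C):\ \frac{\partial f}{\partial\bar z}=0\ \text{in}\ \mathcal G(\mathbb C)\}$ is the set of holomorphic generalized functions. **Theorem.** Every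 $f\in\mathcal G_H(\mathbb C)$ has a representative $(f_\varepsilon)_\varepsilon\in\mathcal E_M(\mathbb C)$, $f=[(f_\varepsilon)_\varepsilon]$, such that $f_\varepsilon$ is an entire function on $\mathbb C$ for every $\varepsilon\in(0,1)$. -/

import Mathlib

open scoped ContDiff

namespace Colombeau

/-- The parameter set `(0,1)` of the nets. -/
abbrev Param : Type := Set.Ioo (0 : ℝ) 1

/-- Nets `(u_ε)_{ε ∈ (0,1)}` of complex valued functions on `ℂ = ℝ²`, with pointwise operations. -/
abbrev Net : Type := Param → ℂ → ℂ

/-- `‖u_ε‖_{W^{m,∞}(K)} = O(ε^a)` as `ε → 0`: near `ε = 0`, all real derivatives of `u_ε` of order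
at most `m` are bounded by `C ε^a` on `K`. The operator norm of the `k`-th real Fréchet derivative
is equivalent to the maximum of the absolute values of the partial derivatives of order `k`. -/
def HasGrowth (u : Net) (m : ℕ) (K : Set ℂ) (a : ℝ) : Prop :=
  ∃ C : ℝ, ∃ ε₀ : ℝ, 0 < ε₀ ∧ ∀ ε : Param, (ε : ℝ) < ε₀ → ∀ k ≤ m, ∀ z ∈ K,
    ‖iteratedFDeriv ℝ k (u ε) z‖ ≤ C * (ε : ℝ) ^ a

/-- Every member of the net is a smooth function on `ℝ²`. -/
def IsSmoothNet (u : Net) : Prop := ∀ ε, ContDiff ℝ ∞ (u ε)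

/-- Moderate nets. -/
def IsModerate (u : Net) : Prop :=
  ∀ m : ℕ, ∀ K : Set ℂ, IsCompact K → ∃ a : ℝ, HasGrowth u m K a

/-- Negligible nets. -/
def IsNegligible (u : Net) : Prop :=
  ∀ m : ℕ, ∀ K : Set ℂ, IsCompact K → ∀ b : ℝ, HasGrowth u m K b

lemma HasGrowth.exists_pos {u : Net} {m : ℕ} {K : Set ℂ} {a : ℝ} (h : HasGrowth u m K a) :
    ∃ C : ℝ, 0 < C ∧ ∃ ε₀ : ℝ, 0 < ε₀ ∧ ∀ ε : Param, (ε : ℝ) < ε₀ → ∀ k ≤ m, ∀ z ∈ K,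
      ‖iteratedFDeriv ℝ k (u ε) z‖ ≤ C * (ε : ℝ) ^ a := by
  obtain ⟨C, ε₀, h0, h⟩ := h
  refine ⟨max C 1, by positivity, ε₀, h0, fun ε hε k hk z hz => (h ε hε k hk z hz).trans ?_⟩
  have := Real.rpow_nonneg ε.2.1.le a
  gcongr
  exact le_max_left _ _

lemma HasGrowth.mono {u : Net} {m : ℕ} {K : Set ℂ} {a b : ℝ} (hab : a ≤ b)
    (h : HasGrowth u m K b) : HasGrowth u m K a := by
  obtain ⟨C, hC, ε₀, h0, h⟩ := h.exists_pos
  refine ⟨C, ε₀, h0, fun ε hε k hk z hz => (h ε hε k hk z hz).trans ?_⟩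
  exact mul_le_mul_of_nonneg_left
    (Real.rpow_le_rpow_of_exponent_ge ε.2.1 ε.2.2.le hab) hC.le

lemma HasGrowth.add {u v : Net} {m : ℕ} {K : Set ℂ} {a : ℝ} (su : IsSmoothNet u)
    (sv : IsSmoothNet v) (hu : HasGrowth u m K a) (hv : HasGrowth v m K a) :
    HasGrowth (u + v) m K a := by
  obtain ⟨C, ε₁, h1, hu⟩ := hu
  obtain ⟨D, ε₂, h2, hv⟩ := hv
  refine ⟨C + D, min ε₁ ε₂, lt_min h1 h2, fun ε hε k hk z hz => ?_⟩
  have e : iteratedFDeriv ℝ k ((u + v) ε) z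
      = iteratedFDeriv ℝ k (u ε) z + iteratedFDeriv ℝ k (v ε) z :=
    iteratedFDeriv_add_apply ((su ε).of_le (mod_cast le_top)).contDiffAt
      ((sv ε).of_le (mod_cast le_top)).contDiffAt
  rw [e, add_mul]
  exact (norm_add_le _ _).trans (add_le_add
    (hu ε (hε.trans_le (min_le_left _ _)) k hk z hz)
    (hv ε (hε.trans_le (min_le_right _ _)) k hk z hz))

lemma HasGrowth.mul {u v : Net} {m : ℕ} {K : Set ℂ} {a b : ℝ} (su : IsSmoothNet u)
    (sv : IsSmoothNet v) (hu : HasGrowth u m K a) (hv : HasGrowth v m K b) :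
    HasGrowth (u * v) m K (a + b) := by
  obtain ⟨C, hC, ε₁, h1, hu⟩ := hu.exists_pos
  obtain ⟨D, hD, ε₂, h2, hv⟩ := hv.exists_pos
  refine ⟨2 ^ m * (C * D), min ε₁ ε₂, lt_min h1 h2, fun ε hε k hk z hz => ?_⟩
  have hεa := Real.rpow_nonneg ε.2.1.le a
  have hεb := Real.rpow_nonneg ε.2.1.le b
  have e := norm_iteratedFDeriv_mul_le (su ε) (sv ε) z (n := k) (mod_cast le_top)
  refine e.trans ?_
  rw [Real.rpow_add ε.2.1]
  calc ∑ i ∈ Finset.range (k + 1), (k.choose i : ℝ) * ‖iteratedFDeriv ℝ i (u ε) z‖ *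
          ‖iteratedFDeriv ℝ (k - i) (v ε) z‖
      ≤ ∑ i ∈ Finset.range (k + 1), (k.choose i : ℝ) * (C * (ε : ℝ) ^ a) * (D * (ε : ℝ) ^ b) := by
        refine Finset.sum_le_sum fun i hi => ?_
        have hi' : i ≤ k := by simpa [Nat.lt_succ_iff] using hi
        gcongr
        · exact hu ε (hε.trans_le (min_le_left _ _)) i (hi'.trans hk) z hz
        · exact hv ε (hε.trans_le (min_le_right _ _)) (k - i) ((Nat.sub_le _ _).trans hk) z hz
    _ = 2 ^ k * ((C * D) * ((ε : ℝ) ^ a * (ε : ℝ) ^ b)) := by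
        have := Nat.sum_range_choose k
        rw [← Finset.sum_mul, ← Finset.sum_mul]
        have h' : ∑ i ∈ Finset.range (k + 1), (k.choose i : ℝ) = 2 ^ k := by exact_mod_cast this
        rw [h']; ring
    _ ≤ 2 ^ m * ((C * D) * ((ε : ℝ) ^ a * (ε : ℝ) ^ b)) := by
        gcongr
        norm_num
    _ = _ := by ring

lemma hasGrowth_const (c : ℂ) (m : ℕ) (K : Set ℂ) : HasGrowth (fun _ _ => c) m K 0 := by
  refine ⟨‖c‖, 1, one_pos, fun ε _ k _ z _ => ?_⟩
  rcases k.eq_zero_or_pos with rfl | hk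
  · simp
  · rw [iteratedFDeriv_const_of_ne (𝕜 := ℝ) hk.ne' c]
    simp

/-- The algebra of moderate nets of smooth functions on `ℂ`. -/
def moderateNets : Subalgebra ℂ Net where
  carrier := {u | IsSmoothNet u ∧ IsModerate u}
  add_mem' := by
    rintro u v ⟨su, hu⟩ ⟨sv, hv⟩
    refine ⟨fun ε => (su ε).add (sv ε), fun m K hK => ?_⟩
    obtain ⟨a, ha⟩ := hu m K hK
    obtain ⟨b, hb⟩ := hv m K hK
    exact ⟨min a b, (ha.mono (min_le_left _ _)).add su sv (hb.mono (min_le_right _ _))⟩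
  mul_mem' := by
    rintro u v ⟨su, hu⟩ ⟨sv, hv⟩
    refine ⟨fun ε => (su ε).mul (sv ε), fun m K hK => ?_⟩
    obtain ⟨a, ha⟩ := hu m K hK
    obtain ⟨b, hb⟩ := hv m K hK
    exact ⟨a + b, ha.mul su sv hb⟩
  algebraMap_mem' c := ⟨fun _ => contDiff_const, fun m K _ => ⟨0, hasGrowth_const c m K⟩⟩

/-- The ideal of negligible nets. -/
def negligibleNets : Ideal moderateNets where
  carrier := {u | IsNegligible (u : Net)}
  add_mem' := fun {u v} hu hv m K hK b => (hu m K hK b).add u.2.1 v.2.1 (hv m K hK b)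
  zero_mem' := fun m K _ b => by
    refine ⟨0, 1, one_pos, fun ε _ k _ z _ => ?_⟩
    have : ((0 : moderateNets) : Net) ε = fun _ => 0 := rfl
    rw [this, iteratedFDeriv_fun_zero]
    simp
  smul_mem' := fun c u hu m K hK b => by
    obtain ⟨a, ha⟩ := c.2.2 m K hK
    have := ha.mul c.2.1 u.2.1 (hu m K hK (b - a))
    rwa [add_sub_cancel] at this

/-- The Colombeau algebra `𝒢(ℂ)` of generalized functions: moderate modulo negligible nets. -/
abbrev GeneralizedFunction : Type := moderateNets ⧸ negligibleNets

/-- The class `[(u_ε)_ε]` of a moderate net; `u` is a representative of `mk u`. -/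
def mk (u : moderateNets) : GeneralizedFunction := Ideal.Quotient.mk negligibleNets u

/-- The Cauchy-Riemann operator `∂/∂z̄ = (∂/∂x + i ∂/∂y) / 2` on functions. -/
noncomputable def dbarFun (f : ℂ → ℂ) (z : ℂ) : ℂ :=
  (1 / 2) * (fderiv ℝ f z 1 + Complex.I * fderiv ℝ f z Complex.I)

/-- The linear form through which `∂/∂z̄` factors over the real Fréchet derivative. -/
noncomputable def dbarForm : (ℂ →L[ℝ] ℂ) →L[ℝ] ℂ :=
  (1 / 2 : ℂ) • (ContinuousLinearMap.apply ℝ ℂ (1 : ℂ)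
    + Complex.I • ContinuousLinearMap.apply ℝ ℂ Complex.I)

lemma dbarFun_eq (f : ℂ → ℂ) : dbarFun f = dbarForm ∘ fderiv ℝ f := by
  ext z
  simp [dbarFun, dbarForm, mul_add]

lemma contDiff_dbarFun {f : ℂ → ℂ} (hf : ContDiff ℝ ∞ f) : ContDiff ℝ ∞ (dbarFun f) := by
  rw [dbarFun_eq]
  exact dbarForm.contDiff.comp (hf.fderiv_right (by simp))

lemma HasGrowth.dbar {u : Net} {m : ℕ} {K : Set ℂ} {a : ℝ} (su : IsSmoothNet u)
    (hu : HasGrowth u (m + 1) K a) : HasGrowth (fun ε => dbarFun (u ε)) m K a := by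
  obtain ⟨C, ε₀, h0, hu⟩ := hu
  refine ⟨‖dbarForm‖ * C, ε₀, h0, fun ε hε k hk z hz => ?_⟩
  have hs : ContDiff ℝ ∞ (fderiv ℝ (u ε)) := (su ε).fderiv_right (by simp)
  have h1 := dbarForm.norm_iteratedFDeriv_comp_left (x := z) hs.contDiffAt
    (n := k) (mod_cast le_top)
  simp only [dbarFun_eq]
  refine h1.trans ?_
  rw [norm_iteratedFDeriv_fderiv, mul_assoc]
  gcongr
  exact hu ε hε (k + 1) (by omega) z hz

lemma dbarFun_add {f g : ℂ → ℂ} (hf : ContDiff ℝ ∞ f) (hg : ContDiff ℝ ∞ g) :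
    dbarFun (f + g) = dbarFun f + dbarFun g := by
  ext z
  have := fderiv_add (hf.differentiable (by simp) z) (hg.differentiable (by simp) z)
  simp only [dbarFun, this, Pi.add_apply, add_apply]
  ring

/-- `∂/∂z̄` on moderate nets, member by member. -/
noncomputable def dbarNet : moderateNets →+ moderateNets where
  toFun u := ⟨fun ε => dbarFun ((u : Net) ε), fun ε => contDiff_dbarFun (u.2.1 ε), fun m K hK =>
    (u.2.2 (m + 1) K hK).imp fun _ h => h.dbar u.2.1⟩
  map_zero' := by
    ext ε z
    have : ((0 : moderateNets) : Net) ε = fun _ => 0 := rfl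
    simp [dbarFun, this]
  map_add' u v := Subtype.ext <| funext fun ε => dbarFun_add (u.2.1 ε) (v.2.1 ε)

lemma negligibleNets_le_comap_dbarNet :
    negligibleNets.toAddSubgroup ≤ negligibleNets.toAddSubgroup.comap dbarNet :=
  fun u hu m K hK b => (hu (m + 1) K hK b).dbar u.2.1

/-- The induced operator `∂/∂z̄ : 𝒢(ℂ) → 𝒢(ℂ)`, `[(u_ε)_ε] ↦ [(∂u_ε/∂z̄)_ε]`. -/
noncomputable def dbar : GeneralizedFunction →+ GeneralizedFunction :=
  QuotientAddGroup.map negligibleNets.toAddSubgroup negligibleNets.toAddSubgroup dbarNet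
    negligibleNets_le_comap_dbarNet

lemma dbar_mk (u : moderateNets) : dbar (mk u) = mk (dbarNet u) := rfl

/-- The set `𝒢_H(ℂ)` of holomorphic generalized functions on `ℂ`. -/
def holomorphicGeneralizedFunctions : Set GeneralizedFunction := {f | dbar f = 0}

end Colombeau

namespace Colombeau

/-! Start from any representative `u`; its `∂/∂z̄` is negligible. On a disc of radius `R`, a smooth
function with `|∂u/∂z̄| ≤ δ` differs from its Cauchy integral by at most `2Rδ`
(`norm_sub_cauchy_integral_le`). The Cauchy integral is holomorphic only inside the disc, but a
Taylor polynomial of it is entire and as close as desired on a smaller disc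
(`exists_entire_norm_sub_le`). Letting the disc grow and the tolerance shrink, slowly enough, as `ε
→ 0` yields one net `p` of entire functions with `p - u = O(ε^b)` on every disc for every `b`
(`exists_entire_net`).

This controls values only. Cauchy estimates make `p` moderate, hence `p - u` is moderate. Landau's
inequality interpolates between the negligible bounds on a derivative and the moderate bounds two
orders higher, so negligibility climbs from order zero to all orders (`isNegligible_of_order_zero`).
-/

/-! ### Cauchy's formula with error, and approximation by polynomials. -/

/-- Split `L` into its complex-linear and antilinear parts, `L h = A h + D h̄`. The linear part
commutes with multiplication by `k / q` and cancels; only the antilinear part, whose coefficient is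
`∂/∂z̄` when `L` is a derivative, survives. -/
lemma norm_apply_mul_div_sub_le (L : ℂ →L[ℝ] ℂ) {q : ℂ} (hq : q ≠ 0) (k : ℂ) :
    ‖L q * (k / q) - L k‖ ≤ 2 * ‖(1 / 2) * (L 1 + Complex.I * L Complex.I)‖ * ‖k‖ := by
  set D : ℂ := (1 / 2) * (L 1 + Complex.I * L Complex.I) with hD
  have hL : ∀ h : ℂ, L h = (1 / 2) * (L 1 - Complex.I * L Complex.I) * h
      + D * (starRingEnd ℂ) h := by
    intro h
    have e : h = h.re • (1 : ℂ) + h.im • Complex.I := by simp [Complex.re_add_im]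
    have e1 : L h = h.re * L 1 + h.im * L Complex.I := by
      conv_lhs => rw [e, map_add, map_smul, map_smul]
      simp
    have e2 : (starRingEnd ℂ) h = h.re - h.im * Complex.I := by
      apply Complex.ext <;> simp
    have e3 : h = h.re + h.im * Complex.I := (Complex.re_add_im h).symm
    rw [e1, e2]
    conv_rhs => enter [1, 2]; rw [e3]
    rw [hD]
    linear_combination ((h.im : ℂ) * L Complex.I) * Complex.I_mul_I
  have key : L q * (k / q) - L k
      = D * ((starRingEnd ℂ) q * (k / q) - (starRingEnd ℂ) k) := by
    rw [hL q, hL k]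
    field_simp
    ring
  have hb : ‖(starRingEnd ℂ) q * (k / q) - (starRingEnd ℂ) k‖ ≤ 2 * ‖k‖ := by
    refine (norm_sub_le _ _).trans (le_of_eq ?_)
    have : ‖q‖ ≠ 0 := norm_ne_zero_iff.2 hq
    rw [norm_mul, norm_div, RCLike.norm_conj, RCLike.norm_conj]
    field_simp
    ring
  rw [key, norm_mul]
  calc _ ≤ ‖D‖ * (2 * ‖k‖) := by gcongr
    _ = _ := by ring

/-- The error in Cauchy's integral formula is controlled by the `∂/∂z̄` derivative. -/
lemma norm_sub_cauchy_integral_le {u : ℂ → ℂ} (hu : ContDiff ℝ ∞ u) {R δ : ℝ} {z : ℂ}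
    (hz : z ∈ Metric.ball (0 : ℂ) R)
    (hδ : ∀ w ∈ Metric.closedBall (0 : ℂ) R, ‖dbarFun u w‖ ≤ δ) :
    ‖u z - (2 * Real.pi * Complex.I : ℂ)⁻¹ • ∮ w in C(0, R), (w - z)⁻¹ • u w‖ ≤ 2 * R * δ := by
  have hzR : ‖z‖ < R := by simpa using hz
  have hR : 0 < R := (norm_nonneg z).trans_lt hzR
  set q : ℝ → ℂ := fun θ => circleMap 0 R θ - z with hq
  set k : ℝ → ℂ := fun θ => circleMap 0 R θ * Complex.I with hk
  have hqc : Continuous q := by fun_prop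
  have hkc : Continuous k := by fun_prop
  have hkn : ∀ θ, ‖k θ‖ = R := fun θ => by simp [hk, abs_of_pos hR]
  have hq0 : ∀ θ, q θ ≠ 0 := fun θ h => by
    have : circleMap 0 R θ = z := sub_eq_zero.1 h
    rw [← this] at hzR
    simp [abs_of_pos hR] at hzR
  have hqd : ∀ θ, HasDerivAt q (k θ) θ := fun θ => (hasDerivAt_circleMap 0 R θ).sub_const z
  have hud : Differentiable ℝ u := hu.differentiable (by simp)
  have hfc : Continuous (fderiv ℝ u) := hu.continuous_fderiv (by simp)
  -- Contract the circle to `z` along `z + t q(θ)`. Integrating `F` over `t` first gives the Cauchy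
  -- integrand of `u - u z`; integrating over `θ` first gives a quantity that would vanish for
  -- holomorphic `u`.
  set F : ℝ → ℝ → ℂ := fun θ t => fderiv ℝ u (z + t • q θ) (q θ) * (k θ / q θ) with hF
  have hFc : Continuous (Function.uncurry F) := by
    have h1 : Continuous fun p : ℝ × ℝ => fderiv ℝ u (z + p.2 • q p.1) (q p.1) :=
      (hfc.comp (by fun_prop)).clm_apply (by fun_prop)
    exact h1.mul ((hkc.comp continuous_fst).div (hqc.comp continuous_fst) fun p => hq0 p.1)
  have hinner : ∀ θ, ∫ t in (0 : ℝ)..1, F θ t = (u (circleMap 0 R θ) - u z) * (k θ / q θ) := by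
    intro θ
    have hd : ∀ t ∈ Set.uIcc (0 : ℝ) 1,
        HasDerivAt (fun t : ℝ => u (z + t • q θ)) (fderiv ℝ u (z + t • q θ) (q θ)) t := by
      intro t _
      have h1 : HasDerivAt (fun t : ℝ => z + t • q θ) (q θ) t := by
        simpa using ((hasDerivAt_id t).smul_const (q θ)).const_add z
      exact (hud _).hasFDerivAt.comp_hasDerivAt t h1
    have hc : Continuous fun t : ℝ => fderiv ℝ u (z + t • q θ) (q θ) :=
      (hfc.comp (by fun_prop)).clm_apply continuous_const
    rw [hF]
    simp only [intervalIntegral.integral_mul_const]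
    rw [intervalIntegral.integral_eq_sub_of_hasDerivAt hd (hc.intervalIntegrable _ _)]
    simp [hq]
  have houter : ∀ t ∈ Set.Ioc (0 : ℝ) 1,
      ‖∫ θ in (0 : ℝ)..(2 * Real.pi), F θ t‖ ≤ 4 * Real.pi * R * δ := by
    intro t ht
    have hd : ∀ θ ∈ Set.uIcc (0 : ℝ) (2 * Real.pi),
        HasDerivAt (fun θ : ℝ => u (z + t • q θ)) (fderiv ℝ u (z + t • q θ) (t • k θ)) θ :=
      fun θ _ => (hud _).hasFDerivAt.comp_hasDerivAt θ (((hqd θ).const_smul t).const_add z)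
    have hc : Continuous fun θ : ℝ => fderiv ℝ u (z + t • q θ) (k θ) :=
      (hfc.comp (by fun_prop)).clm_apply hkc
    have hc' : Continuous fun θ : ℝ => fderiv ℝ u (z + t • q θ) (t • k θ) :=
      (hfc.comp (by fun_prop)).clm_apply (by fun_prop)
    -- Up to the factor `t ≠ 0`, the integrand is the `θ`-derivative of `u` along a closed curve.
    -- Subtracting it from `F` leaves only the `∂/∂z̄` error.
    have h0 : ∫ θ in (0 : ℝ)..(2 * Real.pi), fderiv ℝ u (z + t • q θ) (k θ) = 0 := by
      have h1 := intervalIntegral.integral_eq_sub_of_hasDerivAt hd (hc'.intervalIntegrable _ _)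
      have hper : q (2 * Real.pi) = q 0 := by simp [hq, circleMap]
      rw [hper, sub_self] at h1
      simp only [map_smul, intervalIntegral.integral_smul] at h1
      exact (smul_eq_zero.1 h1).resolve_left ht.1.ne'
    have hFt : Continuous fun θ => F θ t := hFc.comp (by fun_prop : Continuous fun θ : ℝ => (θ, t))
    have h2 : ∫ θ in (0 : ℝ)..(2 * Real.pi), F θ t
        = ∫ θ in (0 : ℝ)..(2 * Real.pi), (F θ t - fderiv ℝ u (z + t • q θ) (k θ)) := by
      rw [intervalIntegral.integral_sub (hFt.intervalIntegrable _ _)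
        (hc.intervalIntegrable _ _), h0, sub_zero]
    rw [h2]
    have h3 := intervalIntegral.norm_integral_le_of_norm_le_const (a := (0 : ℝ))
      (b := 2 * Real.pi) (C := 2 * δ * R)
      (f := fun θ => F θ t - fderiv ℝ u (z + t • q θ) (k θ)) fun θ _ => by
        refine (norm_apply_mul_div_sub_le _ (hq0 θ) (k θ)).trans ?_
        rw [hkn]
        have hmem : z + t • q θ ∈ Metric.closedBall (0 : ℂ) R := by
          have h5 : circleMap 0 R θ ∈ Metric.closedBall (0 : ℂ) R :=
            circleMap_mem_closedBall _ hR.le _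
          exact (convex_closedBall (0 : ℂ) R).add_smul_sub_mem
            (Metric.ball_subset_closedBall hz) h5 ⟨ht.1.le, ht.2⟩
        have := hδ _ hmem
        rw [dbarFun] at this
        gcongr
    refine h3.trans (le_of_eq ?_)
    rw [sub_zero, abs_of_pos Real.two_pi_pos]
    ring
  have hcirc : ∮ w in C(0, R), (w - z)⁻¹ • (u w - u z)
      = ∫ t in (0 : ℝ)..1, ∫ θ in (0 : ℝ)..(2 * Real.pi), F θ t := by
    rw [← MeasureTheory.intervalIntegral_intervalIntegral_swap, circleIntegral]
    · refine intervalIntegral.integral_congr fun θ _ => ?_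
      simp only [hinner, deriv_circleMap, hk, hq, smul_eq_mul, div_eq_mul_inv]
      ring
    · exact (hFc.continuousOn.integrableOn_compact
        (isCompact_uIcc.prod isCompact_uIcc)).mono_set
        (Set.prod_mono Set.uIoc_subset_uIcc Set.uIoc_subset_uIcc)
  have hint : ∀ g : ℂ → ℂ, Continuous g →
      CircleIntegrable (fun w => (w - z)⁻¹ • g w) 0 R := by
    intro g hg
    refine ContinuousOn.circleIntegrable hR.le ?_
    refine ContinuousOn.smul (ContinuousOn.inv₀ (continuous_id.sub continuous_const).continuousOn
      fun w hw h => ?_) hg.continuousOn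
    obtain rfl : w = z := sub_eq_zero.1 h
    simp at hw
    exact hzR.ne hw
  have hpi : (2 * Real.pi * Complex.I : ℂ) ≠ 0 := Complex.two_pi_I_ne_zero
  have hfin : u z - (2 * Real.pi * Complex.I : ℂ)⁻¹ • ∮ w in C(0, R), (w - z)⁻¹ • u w
      = -((2 * Real.pi * Complex.I : ℂ)⁻¹ • ∮ w in C(0, R), (w - z)⁻¹ • (u w - u z)) := by
    have h1 := circleIntegral.integral_sub (hint u hu.continuous) (hint (fun _ => u z) continuous_const)
    simp only [← smul_sub] at h1
    rw [h1, circleIntegral.integral_smul_const, circleIntegral.integral_sub_inv_of_mem_ball hz,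
      smul_sub, smul_smul, inv_mul_cancel₀ hpi]
    simp
  rw [hfin, norm_neg, norm_smul, hcirc]
  have h4 := intervalIntegral.norm_integral_le_of_norm_le_const (a := (0 : ℝ)) (b := 1)
    (C := 4 * Real.pi * R * δ) (f := fun t => ∫ θ in (0 : ℝ)..(2 * Real.pi), F θ t)
    fun t ht => houter t (by simpa using ht)
  have hn : ‖(2 * Real.pi * Complex.I : ℂ)⁻¹‖ = (2 * Real.pi)⁻¹ := by
    simp [abs_of_pos Real.pi_pos]
  rw [hn]
  have := Real.pi_pos
  calc _ ≤ (2 * Real.pi)⁻¹ * (4 * Real.pi * R * δ * |1 - 0|) := by gcongr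
    _ = _ := by
      simp
      field_simp
      ring

/-- A smooth function that is almost holomorphic on a disc is close to a polynomial on smaller
discs. -/
lemma exists_entire_norm_sub_le {u : ℂ → ℂ} (hu : ContDiff ℝ ∞ u) {r R δ η : ℝ} (hr : 0 ≤ r)
    (hrR : r < R) (hη : 0 < η)
    (hδ : ∀ w ∈ Metric.closedBall (0 : ℂ) R, ‖dbarFun u w‖ ≤ δ) :
    ∃ p : ℂ → ℂ, Differentiable ℂ p ∧
      ∀ z ∈ Metric.closedBall (0 : ℂ) r, ‖p z - u z‖ ≤ 2 * R * δ + η := by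
  have hR : 0 < R := hr.trans_lt hrR
  lift R to NNReal using hR.le
  -- The power series converges uniformly on open balls of radius less than `R`; one of radius `s >
  -- r` contains the closed ball of radius `r`.
  obtain ⟨s, hrs, hsR⟩ := exists_between hrR
  lift s to NNReal using hr.trans hrs.le
  have hps := hasFPowerSeriesOn_cauchy_integral (f := u) (c := 0) (R := R)
    (hu.continuous.continuousOn.circleIntegrable hR.le) (mod_cast hR)
  have htu := hps.tendstoUniformlyOn (r' := s) (by exact_mod_cast hsR)
  obtain ⟨n, hn⟩ := (Metric.tendstoUniformlyOn_iff.1 htu η hη).exists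
  refine ⟨(cauchyPowerSeries u 0 R).partialSum n, ?_, fun z hz => ?_⟩
  · have : (cauchyPowerSeries u 0 R).partialSum n
        = fun z => ∑ i ∈ Finset.range n, z ^ i • (cauchyPowerSeries u 0 R).coeff i := by
      ext z
      simp [FormalMultilinearSeries.partialSum]
    rw [this]
    fun_prop
  · have hz' : ‖z‖ ≤ r := by simpa using hz
    have h1 := hn z (by simpa using hz'.trans_lt hrs)
    have h2 := norm_sub_cauchy_integral_le hu (z := z) (R := R) (by simpa using hz'.trans_lt hrR) hδ
    rw [zero_add, dist_eq_norm] at h1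
    rw [norm_sub_rev]
    calc _ ≤ _ := norm_sub_le_norm_sub_add_norm_sub _ _ _
      _ ≤ _ := add_le_add h2 h1.le

/-! ### Control of derivatives by values. -/

/-- Cauchy estimates for the real Fréchet derivatives of an entire function. -/
lemma exists_norm_iteratedFDeriv_le (k : ℕ) : ∃ C : ℝ, 0 ≤ C ∧ ∀ (p : ℂ → ℂ) (M : ℝ) (z : ℂ),
    Differentiable ℂ p → (∀ w ∈ Metric.closedBall z k, ‖p w‖ ≤ M) →
      ‖iteratedFDeriv ℝ k p z‖ ≤ C * M := by
  induction k with
  | zero => exact ⟨1, zero_le_one, fun p M z _ hM => by simpa using hM z (by simp)⟩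
  | succ k ih =>
    obtain ⟨C, hC, ih⟩ := ih
    let T : ℂ →L[ℝ] ℂ →L[ℝ] ℂ := ContinuousLinearMap.mul ℝ ℂ
    refine ⟨‖T‖ * C, by positivity, fun p M z hp hM => ?_⟩
    have hd : Differentiable ℂ (deriv p) := (hp.contDiff (n := 2)).differentiable_deriv_two
    have hs : ContDiff ℝ ∞ (deriv p) := (hd.contDiff (n := ∞)).restrict_scalars ℝ
    have hf : fderiv ℝ p = T ∘ deriv p := by
      ext1 w
      have := ((hp w).hasDerivAt.hasFDerivAt.restrictScalars ℝ).fderiv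
      rw [this]
      ext h
      simp [T, mul_comm]
    rw [← norm_iteratedFDeriv_fderiv, hf]
    refine (T.norm_iteratedFDeriv_comp_left hs.contDiffAt (n := k) (mod_cast le_top)).trans ?_
    rw [mul_assoc]
    gcongr
    refine ih _ M z hd fun w hw => ?_
    -- Each differentiation costs one unit of radius, so the constant does not depend on `p`.
    have := Complex.norm_deriv_le_of_forall_mem_sphere_norm_le (c := w) (R := 1) (C := M)
      one_pos hp.diffContOnCl fun y hy => hM y ?_
    · simpa using this
    · have h1 : dist y w = 1 := hy
      have h2 : dist w z ≤ k := by simpa using hw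
      have := dist_triangle y w z
      simp only [Metric.mem_closedBall, Nat.cast_add, Nat.cast_one]
      linarith

/-- Landau's inequality: a bound for the first derivative in terms of the function and its second
derivative. -/
lemma norm_fderiv_le_of_second_order {F : Type*} [NormedAddCommGroup F] [NormedSpace ℝ F]
    {g : ℂ → F} (hg : ContDiff ℝ 2 g) {z : ℂ} {t A M : ℝ} (ht : 0 < t)
    (hA : ∀ w ∈ Metric.closedBall z t, ‖g w‖ ≤ A)
    (hM : ∀ w ∈ Metric.closedBall z t, ‖fderiv ℝ (fderiv ℝ g) w‖ ≤ M) :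
    ‖fderiv ℝ g z‖ ≤ 2 * A / t + t * M := by
  have hzz : z ∈ Metric.closedBall z t := by simp [ht.le]
  have hM0 : 0 ≤ M := (norm_nonneg (fderiv ℝ (fderiv ℝ g) z)).trans (hM z hzz)
  have hA0 : 0 ≤ A := (norm_nonneg _).trans (hA z hzz)
  have hd1 : Differentiable ℝ g := hg.differentiable (by simp)
  have hd2 : Differentiable ℝ (fderiv ℝ g) :=
    (hg.fderiv_right (m := 1) (by norm_num)).differentiable (by simp)
  have hcv := convex_closedBall z t
  have hL : ∀ w ∈ Metric.closedBall z t, ‖fderiv ℝ g w - fderiv ℝ g z‖ ≤ M * t := fun w hw => by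
    refine (hcv.norm_image_sub_le_of_norm_fderiv_le (fun x _ => hd2 x) hM hzz hw).trans ?_
    gcongr
    simpa [dist_eq_norm] using hw
  refine ContinuousLinearMap.opNorm_le_of_unit_norm (by positivity) fun v hv => ?_
  have hw : z + t • v ∈ Metric.closedBall z t := by
    simp [hv, abs_of_pos ht]
  have h1 := hcv.norm_image_sub_le_of_norm_fderiv_le' (fun x _ => hd1 x) hL hzz hw
  have hnv : ‖t • v‖ = t := by rw [norm_smul, hv, Real.norm_of_nonneg ht.le, mul_one]
  rw [add_sub_cancel_left, hnv, map_smul] at h1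
  have h2 : ‖t • fderiv ℝ g z v‖ ≤ 2 * A + M * t * t := by
    have h3 := hA _ hw
    have h4 := hA _ hzz
    have h5 := norm_sub_le (g (z + t • v) - g z) (g (z + t • v) - g z - t • fderiv ℝ g z v)
    rw [sub_sub_cancel] at h5
    have h6 := norm_sub_le (g (z + t • v)) (g z)
    linarith
  rw [norm_smul, Real.norm_of_nonneg ht.le] at h2
  rw [show 2 * A / t + t * M = (2 * A + M * t * t) / t by field_simp, le_div_iff₀ ht]
  linarith

set_option maxSynthPendingDepth 8 in
lemma norm_fderiv_fderiv_iteratedFDeriv (f : ℂ → ℂ) (m : ℕ) (z : ℂ) :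
    ‖fderiv ℝ (fderiv ℝ (iteratedFDeriv ℝ m f)) z‖ = ‖iteratedFDeriv ℝ (m + 2) f z‖ := by
  rw [fderiv_iteratedFDeriv, LinearIsometryEquiv.comp_fderiv, ← norm_fderiv_iteratedFDeriv]
  exact (continuousMultilinearCurryLeftEquiv ℝ
    (fun _ : Fin (m + 1) => ℂ) ℂ).toLinearIsometry.norm_toContinuousLinearMap_comp

lemma HasGrowth.mono_set {u : Net} {m : ℕ} {K K' : Set ℂ} {a : ℝ} (hK : K ⊆ K')
    (h : HasGrowth u m K' a) : HasGrowth u m K a := by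
  obtain ⟨C, ε₀, h0, h⟩ := h
  exact ⟨C, ε₀, h0, fun ε hε k hk z hz => h ε hε k hk z (hK hz)⟩

/-- A moderate net is negligible as soon as it satisfies the negligibility estimates of order
zero. -/
lemma isNegligible_of_order_zero {u : Net} (su : IsSmoothNet u) (hu : IsModerate u)
    (h0 : ∀ R b : ℝ, HasGrowth u 0 (Metric.closedBall 0 R) b) : IsNegligible u := by
  have key : ∀ m : ℕ, ∀ R b : ℝ, HasGrowth u m (Metric.closedBall 0 R) b := by
    intro m
    induction m with
    | zero => exact h0
    | succ m ih =>
      intro R b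
      obtain ⟨a, ha⟩ := hu (m + 2) (Metric.closedBall 0 (R + 1)) (isCompact_closedBall _ _)
      -- Landau's inequality is applied at scale `t = ε^c`. Here `c ≥ 0` keeps `t ≤ 1`, so the ball
      -- stays within radius `R + 1`, and `c ≥ b - a` makes `t ε^a ≤ ε^b`. The loss from dividing by
      -- `t` is prepaid by using the inductive bound with exponent `b + c`.
      set c : ℝ := max 0 (b - a) with hc
      obtain ⟨M, hM, ε₁, h1, hb⟩ := ha.exists_pos
      obtain ⟨A, hA, ε₂, h2, hs⟩ := (ih (R + 1) (b + c)).exists_pos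
      refine ⟨2 * A + M, min ε₁ ε₂, lt_min h1 h2, fun ε hε k hk z hz => ?_⟩
      have hεp := ε.2.1
      have hεb : (0 : ℝ) ≤ (ε : ℝ) ^ b := Real.rpow_nonneg hεp.le _
      have hzn : ‖z‖ ≤ R := by simpa using hz
      have hε1 := hε.trans_le (min_le_left _ _)
      have hε2 := hε.trans_le (min_le_right _ _)
      have hle : ∀ {x y : ℝ}, x ≤ y → (ε : ℝ) ^ y ≤ (ε : ℝ) ^ x := fun hxy =>
        Real.rpow_le_rpow_of_exponent_ge hεp ε.2.2.le hxy
      rcases Nat.of_le_succ hk with hk | rfl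
      · refine (hs ε hε2 k hk z (by simpa using hzn.trans (by linarith))).trans ?_
        have : (ε : ℝ) ^ (b + c) ≤ (ε : ℝ) ^ b := hle (by simp [hc])
        calc A * (ε : ℝ) ^ (b + c) ≤ A * (ε : ℝ) ^ b := by gcongr
          _ ≤ _ := by gcongr; linarith
      · have ht : (0 : ℝ) < (ε : ℝ) ^ c := Real.rpow_pos_of_pos hεp _
        have ht1 : (ε : ℝ) ^ c ≤ 1 := Real.rpow_le_one hεp.le ε.2.2.le (le_max_left _ _)
        have hball : ∀ w ∈ Metric.closedBall z ((ε : ℝ) ^ c),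
            w ∈ Metric.closedBall (0 : ℂ) (R + 1) := fun w hw => by
          have h3 : ‖w - z‖ ≤ (ε : ℝ) ^ c := by simpa [dist_eq_norm] using hw
          have h4 := norm_add_le (w - z) z
          rw [sub_add_cancel] at h4
          simp only [mem_closedBall_zero_iff]
          linarith
        have hg : ContDiff ℝ 2 (iteratedFDeriv ℝ m (u ε)) :=
          (contDiff_infty.1 (su ε) (2 + m)).iteratedFDeriv_right (by simp)
        have := norm_fderiv_le_of_second_order hg ht
          (A := A * (ε : ℝ) ^ (b + c)) (M := M * (ε : ℝ) ^ a)
          (fun w hw => hs ε hε2 m le_rfl w (hball w hw))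
          (fun w hw => by
            rw [norm_fderiv_fderiv_iteratedFDeriv]
            exact hb ε hε1 (m + 2) le_rfl w (hball w hw))
        rw [norm_fderiv_iteratedFDeriv] at this
        refine this.trans ?_
        have e1 : 2 * (A * (ε : ℝ) ^ (b + c)) / (ε : ℝ) ^ c = 2 * A * (ε : ℝ) ^ b := by
          rw [Real.rpow_add hεp]
          field_simp
        have e2 : (ε : ℝ) ^ c * (M * (ε : ℝ) ^ a) ≤ M * (ε : ℝ) ^ b := by
          have : (ε : ℝ) ^ (c + a) ≤ (ε : ℝ) ^ b := hle (by linarith [le_max_right 0 (b - a)])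
          rw [Real.rpow_add hεp] at this
          nlinarith
        rw [e1, add_mul]
        linarith
  intro m K hK b
  obtain ⟨R, hR⟩ := hK.isBounded.subset_closedBall 0
  exact (key m R b).mono_set hR

/-- A net of entire functions with moderate growth of order zero is moderate. -/
lemma isModerate_of_entire {p : Net} (hp : ∀ ε, Differentiable ℂ (p ε))
    (h0 : ∀ R : ℝ, ∃ a : ℝ, HasGrowth p 0 (Metric.closedBall 0 R) a) : IsModerate p := by
  intro m K hK
  obtain ⟨R, hR⟩ := hK.isBounded.subset_closedBall 0
  obtain ⟨a, ha⟩ := h0 (R + m)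
  obtain ⟨M, hM, ε₀, h0, hb⟩ := ha.exists_pos
  choose C hC hCb using exists_norm_iteratedFDeriv_le
  refine ⟨a, (∑ k ∈ Finset.range (m + 1), C k) * M, ε₀, h0, fun ε hε k hk z hz => ?_⟩
  have hεa : (0 : ℝ) ≤ (ε : ℝ) ^ a := Real.rpow_nonneg ε.2.1.le _
  refine (hCb k (p ε) (M * (ε : ℝ) ^ a) z (hp ε) fun w hw => ?_).trans ?_
  · have h1 : ‖z‖ ≤ R := by simpa using hR hz
    have h2 : ‖w - z‖ ≤ k := by simpa [dist_eq_norm] using hw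
    have h3 := norm_add_le (w - z) z
    have h4 : (k : ℝ) ≤ m := by exact_mod_cast hk
    rw [sub_add_cancel] at h3
    simpa using hb ε hε 0 le_rfl w (by simp only [mem_closedBall_zero_iff]; linarith)
  · rw [mul_assoc]
    gcongr
    exact Finset.single_le_sum (fun i _ => hC i) (Finset.mem_range.2 (Nat.lt_succ_of_le hk))

/-! ### Diagonal choice of entire approximants, and the theorem. -/

/-- A net with negligible `∂/∂z̄` derivative is approximated by entire functions. -/
lemma exists_entire_net {u : Net} (su : IsSmoothNet u)
    (hu : IsNegligible fun ε => dbarFun (u ε)) :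
    ∃ p : Net, (∀ ε, Differentiable ℂ (p ε)) ∧
      ∀ R b : ℝ, HasGrowth (p - u) 0 (Metric.closedBall 0 R) b := by
  classical
  -- The denominator is chosen so that the error `2Rδ` with `R = n + 1` is exactly `ε^n`.
  let Q : Param → ℕ → Prop := fun ε n => ∀ w ∈ Metric.closedBall (0 : ℂ) (n + 1),
    ‖dbarFun (u ε) w‖ ≤ (ε : ℝ) ^ n / (2 * (n + 1))
  have hQ : ∀ ε : Param, ∃ p : ℂ → ℂ, Differentiable ℂ p ∧ ∀ n : ℕ, (n : ℝ) ≤ (ε : ℝ)⁻¹ →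
      Q ε n → ∀ z ∈ Metric.closedBall (0 : ℂ) n, ‖p z - u ε z‖ ≤ 2 * (ε : ℝ) ^ n := by
    intro ε
    have hεp := ε.2.1
    by_cases h : ∃ n : ℕ, (n : ℝ) ≤ (ε : ℝ)⁻¹ ∧ Q ε n
    -- Take the largest admissible radius. The cap `1/ε` is needed since `Q ε` may hold for every
    -- `n`, for instance if `u ε` is entire; it still tends to infinity as `ε → 0`. The bound
    -- obtained at `N` implies the one at each smaller admissible `m`.
    · set N := Nat.findGreatest (Q ε) ⌊(ε : ℝ)⁻¹⌋₊ with hN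
      obtain ⟨n, hn, hQn⟩ := h
      have hQN : Q ε N := Nat.findGreatest_spec (Nat.le_floor hn) hQn
      obtain ⟨p, hp, hpu⟩ := exists_entire_norm_sub_le (su ε) (Nat.cast_nonneg N)
        (lt_add_one (N : ℝ)) (pow_pos hεp N) hQN
      refine ⟨p, hp, fun m hm hQm z hz => ?_⟩
      have hmN : m ≤ N := Nat.le_findGreatest (Nat.le_floor hm) hQm
      refine (hpu z (Metric.closedBall_subset_closedBall (by exact_mod_cast hmN) hz)).trans ?_
      have : (ε : ℝ) ^ N ≤ (ε : ℝ) ^ m := pow_le_pow_of_le_one hεp.le ε.2.2.le hmN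
      calc _ = 2 * (ε : ℝ) ^ N := by field_simp; ring
        _ ≤ _ := by gcongr
    -- With no admissible radius the requirement is vacuous and any entire function serves.
    · exact ⟨0, differentiable_const 0, fun n hn hQn => absurd ⟨n, hn, hQn⟩ h⟩
  choose p hp hpu using hQ
  refine ⟨p, hp, fun R b => ?_⟩
  obtain ⟨n, hn⟩ := exists_nat_ge (max R b)
  -- The exponent `n + 1` leaves a spare factor `ε`, which absorbs `C * (2 * (n + 1))` for small `ε`
  -- and gives `Q ε n`.
  obtain ⟨C, hC, ε₀, h0, hb⟩ :=
    (hu 0 (Metric.closedBall 0 (n + 1)) (isCompact_closedBall _ _) (n + 1)).exists_pos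
  refine ⟨2, min ε₀ (min (n + 1 : ℝ)⁻¹ (C * (2 * (n + 1)))⁻¹), by positivity,
    fun ε hε k hk z hz => ?_⟩
  have hεp := ε.2.1
  have hε0 : (ε : ℝ) < ε₀ := hε.trans_le (min_le_left _ _)
  have hε1 : (ε : ℝ) < (n + 1 : ℝ)⁻¹ :=
    hε.trans_le ((min_le_right _ _).trans (min_le_left _ _))
  have hε2 : (ε : ℝ) < (C * (2 * (n + 1)))⁻¹ :=
    hε.trans_le ((min_le_right _ _).trans (min_le_right _ _))
  obtain rfl : k = 0 := Nat.le_zero.1 hk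
  have hQn : Q ε n := fun w hw => by
    have h1 : ‖dbarFun (u ε) w‖ ≤ C * (ε : ℝ) ^ (n + 1 : ℝ) := by
      simpa using hb ε hε0 0 le_rfl w hw
    refine h1.trans ?_
    rw [Real.rpow_add hεp, Real.rpow_natCast, Real.rpow_one, le_div_iff₀ (by positivity)]
    have h2 : (ε : ℝ) * (C * (2 * (n + 1))) ≤ 1 := by
      rw [← le_div_iff₀ (by positivity), one_div]
      exact hε2.le
    calc _ = (ε : ℝ) ^ n * ((ε : ℝ) * (C * (2 * (n + 1)))) := by ring
      _ ≤ (ε : ℝ) ^ n * 1 := by gcongr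
      _ = _ := mul_one _
  have hnε : (n : ℝ) ≤ (ε : ℝ)⁻¹ := by
    have := (lt_inv_comm₀ hεp (by positivity)).1 hε1
    linarith
  have := hpu ε n hnε hQn z
    (Metric.closedBall_subset_closedBall ((le_max_left _ _).trans hn) hz)
  rw [norm_iteratedFDeriv_zero]
  refine this.trans ?_
  rw [← Real.rpow_natCast]
  gcongr 2 * ?_
  exact Real.rpow_le_rpow_of_exponent_ge hεp ε.2.2.le ((le_max_right _ _).trans hn)

end Colombeau

theorem mainTheorem12 (f : Colombeau.GeneralizedFunction)
    (hf : f ∈ Colombeau.holomorphicGeneralizedFunctions) :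
    ∃ u : Colombeau.moderateNets, Colombeau.mk u = f ∧
      ∀ ε : Colombeau.Param, Differentiable ℂ ((u : Colombeau.Net) ε) := by
  obtain ⟨v, rfl⟩ := Ideal.Quotient.mk_surjective f
  have hv : Colombeau.dbarNet v ∈ Colombeau.negligibleNets := Ideal.Quotient.eq_zero_iff_mem.1 hf
  obtain ⟨p, hp, hpv⟩ := Colombeau.exists_entire_net v.2.1 hv
  have sp : Colombeau.IsSmoothNet p := fun ε => (hp ε).contDiff.restrict_scalars ℝ
  have sd : Colombeau.IsSmoothNet (p - v) := fun ε => (sp ε).sub (v.2.1 ε)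
  have hpm : Colombeau.IsModerate p := by
    refine Colombeau.isModerate_of_entire hp fun R => ?_
    obtain ⟨a, ha⟩ := v.2.2 0 (Metric.closedBall 0 R) (isCompact_closedBall _ _)
    refine ⟨a, ?_⟩
    have := (hpv R a).add sd v.2.1 ha
    rwa [sub_add_cancel] at this
  let P : Colombeau.moderateNets := ⟨p, sp, hpm⟩
  refine ⟨P, Ideal.Quotient.eq.2 ?_, hp⟩
  exact Colombeau.isNegligible_of_order_zero sd (P - v).2.2 hpv
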